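/- Let $G=\mathbb R\ltimes\mathbb R$ be the affine group with product $(a,b)(a',b')=(a+a',\,b+e^{-a}b')$ and left Haar measure $e^{a}\,da\,db$, and let $\mathcal A=C_c^\infty(G)=C_c^\infty(\mathbb R^2)$ be the algebra (under convolution) of smooth compactly supported complex-valued functions $f(a,b)$ on $G$. For $f\in\mathcal A$ put $$\tilde f(a,\beta)=e^{a}\int_{\mathbb R} f(a,b)\,e^{ib\beta}\,db .$$ For $\nu\in\{+1,-1\}$ (also written $\nu=\pm$) let $\pi_\nu$ be the unitary representation of $G$ on $L^2(\mathbb R,ds)$ given by $(\pi_\nu(a,b)\phi)(s)=e^{i\nu b e^{-s}}\phi(s+a)$, and for $f\in\mathcal A$ let $\pi_\nu(f)$ be the bounded operator $$(\pi_\nu(f)\phi)(s)=\int_{\mathbb R^2} e^{a} f(a,b)\,e^{i\nu b e^{-s}}\phi(s+a)\,da\,db .$$ Let $\theta$ be the unbounded (Duflo–Moore) operator $(\theta\phi)(s)=e^{-s/2}\phi(s)$ on its maximal domain $\{\phi\in L^2(\mathbb R): e^{-s/2}\phi\in L^2(\mathbb R)\}$; products of unbounded operators are taken on their natural domains. Then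 for every $f\in\mathcal A$ and each $\nu\in\{+1,-1\}$ the operators $\pi_\nu(f)\theta^2$, $\theta\,\pi_\nu(f)\,\theta$ and $\theta^2\pi_\nu(f)$ are densely defined and extend to trace class operators on $L^2(\mathbb R)$, the function $\beta\mapsto\tilde f(0,\beta)$ is integrable on $(0,\infty)$ and on $(-\infty,0)$, and the traces of the (unique bounded) extensions are $$\operatorname{Tr}\big(\pi_\nu(f)\theta^2\big)=\operatorname{Tr}\big(\theta\,\pi_\nu(f)\,\theta\big)=\operatorname{Tr}\big(\theta^2\pi_\nu(f)\big)=\begin{cases}\displaystyle\int_0^\infty\tilde f(0,\beta)\,d\beta & \text{for }\nu=+1,\\[8pt]\displaystyle\int_{-\infty}^0\tilde f(0,\beta)\,d\beta & \text{for }\nu=-1.\end{cases}$$ -/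

import Mathlib

open MeasureTheory Set
open scoped ENNReal InnerProductSpace

noncomputable section

namespace KappaAffine

/-! ### Unbounded operators and the trace class -/

section Operators

variable {H : Type*} [NormedAddCommGroup H] [InnerProductSpace ℂ H]

/-- The product `S T` of two unbounded operators on its natural domain
`{x ∈ dom T | T x ∈ dom S}`. -/
def ucomp (S T : H →ₗ.[ℂ] H) : H →ₗ.[ℂ] H where
  domain :=
    { carrier := {x | ∃ h : x ∈ T.domain, T ⟨x, h⟩ ∈ S.domain}
      add_mem' := by
        rintro x y ⟨hx, hx'⟩ ⟨hy, hy'⟩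
        refine ⟨add_mem hx hy, ?_⟩
        have := T.map_add ⟨x, hx⟩ ⟨y, hy⟩
        simp only [AddMemClass.mk_add_mk] at this
        rw [this]
        exact add_mem hx' hy'
      zero_mem' := by
        refine ⟨zero_mem _, ?_⟩
        have : T ⟨0, zero_mem _⟩ = 0 := T.map_zero
        rw [this]
        exact zero_mem _
      smul_mem' := by
        rintro c x ⟨hx, hx'⟩
        refine ⟨Submodule.smul_mem _ c hx, ?_⟩
        have := T.map_smul c ⟨x, hx⟩
        simp only [SetLike.mk_smul_mk] at this
        rw [this]
        exact Submodule.smul_mem _ c hx' }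
  toFun :=
    { toFun := fun x => S ⟨T ⟨x.1, x.2.choose⟩, x.2.choose_spec⟩
      map_add' := by
        rintro ⟨x, hx, hx'⟩ ⟨y, hy, hy'⟩
        rw [← S.map_add]
        congr 1
        apply Subtype.ext
        exact T.map_add ⟨x, hx⟩ ⟨y, hy⟩
      map_smul' := by
        rintro c ⟨x, hx, hx'⟩
        simp only [RingHom.id_apply]
        rw [← S.map_smul]
        congr 1
        apply Subtype.ext
        exact T.map_smul c ⟨x, hx⟩ }

/-- A bounded operator viewed as an everywhere defined unbounded operator. -/
def ofBounded (T : H →L[ℂ] H) : H →ₗ.[ℂ] H := T.toLinearMap.toPMap ⊤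

end Operators

/-- A bounded operator `T` is trace class if `∑ᵢ ⟨eᵢ, |T| eᵢ⟩ < ∞` for every orthonormal basis
`(eᵢ)`, where `|T| = (T* T)^{1/2}`. -/
def IsTraceClass {H : Type} [NormedAddCommGroup H] [InnerProductSpace ℂ H] [CompleteSpace H]
    (T : H →L[ℂ] H) : Prop :=
  ∀ (ι : Type) (e : HilbertBasis ι ℂ H), Summable fun i => (⟪e i, CFC.abs T (e i)⟫_ℂ).re

/-- `Tr T = z`: in every orthonormal basis `(eᵢ)` the series `∑ᵢ ⟨eᵢ, T eᵢ⟩` converges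
(unconditionally) to `z`. -/
def HasTrace {H : Type} [NormedAddCommGroup H] [InnerProductSpace ℂ H]
    (T : H →L[ℂ] H) (z : ℂ) : Prop :=
  ∀ (ι : Type) (e : HilbertBasis ι ℂ H), HasSum (fun i => ⟪e i, T (e i)⟫_ℂ) z

/-- The densely defined operator `R` is (i.e. extends by continuity to) a trace class operator
on the whole space, and the trace of this extension is `z`. -/
def IsTraceClassWithTrace {H : Type} [NormedAddCommGroup H] [InnerProductSpace ℂ H]
    [CompleteSpace H] (R : H →ₗ.[ℂ] H) (z : ℂ) : Prop :=
  Dense (R.domain : Set H) ∧ ∃ T : H →L[ℂ] H, R ≤ ofBounded T ∧ IsTraceClass T ∧ HasTrace T z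

/-! ### The algebra of test functions on the affine group

The group is `ℝ × ℝ` with `(a, b) (a', b') = (a + a', b + e^{-a} b')` and left Haar measure
`e^a da db`. -/

/-- The smooth compactly supported complex functions `f(a, b)` on the group. -/
abbrev AlgA : Type := TestFunction (⊤ : TopologicalSpace.Opens (ℝ × ℝ)) ℂ ⊤

/-- The partial Fourier transform `f̃(a, β) = e^a ∫ f(a, b) e^{i b β} db`. -/
def fTilde (f : AlgA) (a β : ℝ) : ℂ :=
  (Real.exp a : ℂ) * ∫ b : ℝ, f (a, b) * Complex.exp (Complex.I * b * β)

/-- The Hilbert space `L²(ℝ, ds)`. -/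
abbrev Hil : Type := Lp ℂ 2 (volume : Measure ℝ)

/-- The representation `(π_ν(a, b) φ)(s) = e^{ν i b e^{-s}} φ(s + a)` of the group, on functions. -/
def piGroup (ν : ℝ) (p : ℝ × ℝ) (φ : ℝ → ℂ) (s : ℝ) : ℂ :=
  Complex.exp (ν * Complex.I * p.2 * Real.exp (-s)) * φ (s + p.1)

/-- The integrated representation `∫ e^a f(a, b) (π_ν(a, b) φ)(s) da db`, on functions. -/
def piFun (ν : ℝ) (f : AlgA) (φ : ℝ → ℂ) (s : ℝ) : ℂ :=
  ∫ p : ℝ × ℝ, (Real.exp p.1 : ℂ) * f p * piGroup ν p φ s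

section Boundedness

variable (ν : ℝ) (f : AlgA)

/-- The `L¹` norm of `f` for the left Haar measure. -/
def l1 : ℝ≥0∞ := ∫⁻ p : ℝ × ℝ, ‖(Real.exp p.1 : ℂ) * f p‖ₑ

lemma continuous_weight : Continuous fun p : ℝ × ℝ => (Real.exp p.1 : ℂ) * f p := by
  have := f.continuous
  fun_prop

lemma l1_ne_top : l1 f ≠ ∞ := by
  have hc := continuous_weight f
  have hs : HasCompactSupport fun p : ℝ × ℝ => (Real.exp p.1 : ℂ) * f p :=
    f.hasCompactSupport.mul_left
  exact (hc.integrable_of_hasCompactSupport hs).2.ne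

lemma enorm_integrand (φ : ℝ → ℂ) (s : ℝ) (p : ℝ × ℝ) :
    ‖(Real.exp p.1 : ℂ) * f p * piGroup ν p φ s‖ₑ
      = ‖(Real.exp p.1 : ℂ) * f p‖ₑ * ‖φ (s + p.1)‖ₑ := by
  rw [enorm_mul _ (piGroup ν p φ s), piGroup, enorm_mul _ (φ (s + p.1))]
  have h : (ν * Complex.I * p.2 * Real.exp (-s) : ℂ)
      = ((ν * p.2 * Real.exp (-s) : ℝ) : ℂ) * Complex.I := by push_cast; ring
  have : ‖Complex.exp (ν * Complex.I * p.2 * Real.exp (-s) : ℂ)‖ₑ = 1 := by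
    rw [h, ← ofReal_norm, Complex.norm_exp_ofReal_mul_I, ENNReal.ofReal_one]
  rw [this, one_mul]

lemma stronglyMeasurable_integrand {φ : ℝ → ℂ} (hφ : StronglyMeasurable φ) :
    StronglyMeasurable fun q : ℝ × (ℝ × ℝ) =>
      (Real.exp q.2.1 : ℂ) * f q.2 * piGroup ν q.2 φ q.1 := by
  have h1 : Continuous fun q : ℝ × (ℝ × ℝ) => (Real.exp q.2.1 : ℂ) * f q.2 :=
    (continuous_weight f).comp continuous_snd
  have h2 : Continuous fun q : ℝ × (ℝ × ℝ) =>
      Complex.exp (ν * Complex.I * q.2.2 * Real.exp (-q.1)) := by fun_prop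
  have h3 : StronglyMeasurable fun q : ℝ × (ℝ × ℝ) => φ (q.1 + q.2.1) :=
    hφ.comp_measurable (by fun_prop)
  exact h1.stronglyMeasurable.mul (h2.stronglyMeasurable.mul h3)

lemma stronglyMeasurable_piFun {φ : ℝ → ℂ} (hφ : StronglyMeasurable φ) :
    StronglyMeasurable (piFun ν f φ) :=
  (stronglyMeasurable_integrand ν f hφ).integral_prod_right

/-- Cauchy–Schwarz. -/
lemma sq_lintegral_le {φ : ℝ → ℂ} (hφ : StronglyMeasurable φ) (s : ℝ) :
    (∫⁻ p : ℝ × ℝ, ‖(Real.exp p.1 : ℂ) * f p‖ₑ * ‖φ (s + p.1)‖ₑ) ^ 2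
      ≤ l1 f * ∫⁻ p : ℝ × ℝ, ‖(Real.exp p.1 : ℂ) * f p‖ₑ * ‖φ (s + p.1)‖ₑ ^ 2 := by
  set w : ℝ × ℝ → ℝ≥0∞ := fun p => ‖(Real.exp p.1 : ℂ) * f p‖ₑ with hw
  have hwm : Measurable w := (continuous_weight f).measurable.enorm
  have hpm : Measurable fun p : ℝ × ℝ => ‖φ (s + p.1)‖ₑ :=
    (hφ.measurable.comp (by fun_prop : Measurable fun p : ℝ × ℝ => s + p.1)).enorm
  have hcs := ENNReal.lintegral_mul_le_Lp_mul_Lq (volume : Measure (ℝ × ℝ))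
    Real.HolderConjugate.two_two
    (f := fun p => w p ^ (1 / 2 : ℝ)) (g := fun p => w p ^ (1 / 2 : ℝ) * ‖φ (s + p.1)‖ₑ)
    (hwm.pow_const _).aemeasurable ((hwm.pow_const _).mul hpm).aemeasurable
  have e0 : ∀ p, w p ^ (1 / 2 : ℝ) * w p ^ (1 / 2 : ℝ) = w p := fun p => by
    rw [← ENNReal.rpow_add_of_nonneg _ _ (by norm_num) (by norm_num)]; norm_num
  have e1 : ∀ p, (w p ^ (1 / 2 : ℝ)) ^ (2 : ℝ) = w p := fun p => by
    rw [← ENNReal.rpow_mul]; norm_num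
  simp only [Pi.mul_apply, ← mul_assoc, e0, ENNReal.mul_rpow_of_nonneg _ _ zero_le_two, e1] at hcs
  have e2 : ∀ x : ℝ≥0∞, (x ^ (1 / 2 : ℝ)) ^ 2 = x := fun x => by
    rw [← ENNReal.rpow_natCast, ← ENNReal.rpow_mul]; norm_num
  calc _ ≤ _ := pow_le_pow_left' hcs 2
    _ = _ := by
      rw [mul_pow, e2, e2]
      simp [l1, hw]

lemma lintegral_sq_le {φ : ℝ → ℂ} (hφ : StronglyMeasurable φ) :
    ∫⁻ s : ℝ, l1 f * ∫⁻ p : ℝ × ℝ, ‖(Real.exp p.1 : ℂ) * f p‖ₑ * ‖φ (s + p.1)‖ₑ ^ 2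
      = l1 f ^ 2 * ∫⁻ s : ℝ, ‖φ s‖ₑ ^ 2 := by
  have hwm : Measurable fun p : ℝ × ℝ => ‖(Real.exp p.1 : ℂ) * f p‖ₑ :=
    (continuous_weight f).measurable.enorm
  have hm : Measurable fun q : ℝ × (ℝ × ℝ) =>
      ‖(Real.exp q.2.1 : ℂ) * f q.2‖ₑ * ‖φ (q.1 + q.2.1)‖ₑ ^ 2 :=
    (hwm.comp measurable_snd).mul ((hφ.measurable.comp
      (by fun_prop : Measurable fun q : ℝ × (ℝ × ℝ) => q.1 + q.2.1)).enorm.pow_const 2)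
  rw [lintegral_const_mul' _ _ (l1_ne_top f), lintegral_lintegral_swap hm.aemeasurable]
  have : ∀ p : ℝ × ℝ, ∫⁻ s : ℝ, ‖(Real.exp p.1 : ℂ) * f p‖ₑ * ‖φ (s + p.1)‖ₑ ^ 2
      = ‖(Real.exp p.1 : ℂ) * f p‖ₑ * ∫⁻ s : ℝ, ‖φ s‖ₑ ^ 2 := fun p => by
    rw [lintegral_const_mul' _ _ enorm_ne_top,
      lintegral_add_right_eq_self (fun s => ‖φ s‖ₑ ^ 2) p.1]
  simp only [this]
  rw [lintegral_mul_const _ hwm, ← mul_assoc, sq]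
  rfl

lemma integrable_integrand {φ : ℝ → ℂ} (hφ : StronglyMeasurable φ) (hφ2 : MemLp φ 2) :
    ∀ᵐ s : ℝ, Integrable fun p : ℝ × ℝ => (Real.exp p.1 : ℂ) * f p * piGroup ν p φ s := by
  have hfin : ∫⁻ s : ℝ, (∫⁻ p : ℝ × ℝ, ‖(Real.exp p.1 : ℂ) * f p‖ₑ * ‖φ (s + p.1)‖ₑ) ^ 2 ≠ ∞ := by
    refine ne_top_of_le_ne_top ?_ (lintegral_mono fun s => sq_lintegral_le f hφ s)
    rw [lintegral_sq_le f hφ]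
    refine ENNReal.mul_ne_top (ENNReal.pow_ne_top (l1_ne_top f)) ?_
    have := (eLpNorm_lt_top_iff_lintegral_rpow_enorm_lt_top (by norm_num) (by norm_num)).1 hφ2.2
    simpa using this.ne
  have hm := stronglyMeasurable_integrand ν f hφ
  have hm' : Measurable fun s : ℝ =>
      (∫⁻ p : ℝ × ℝ, ‖(Real.exp p.1 : ℂ) * f p‖ₑ * ‖φ (s + p.1)‖ₑ) ^ 2 := by
    have h := (hm.enorm).lintegral_prod_right' (ν := (volume : Measure (ℝ × ℝ)))
    simp only [enorm_integrand] at h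
    exact h.pow_const 2
  filter_upwards [ae_lt_top hm' hfin] with s hs
  refine ⟨(hm.comp_measurable measurable_prodMk_left).aestronglyMeasurable, ?_⟩
  rw [HasFiniteIntegral]
  simp only [enorm_integrand]
  by_contra h
  rw [not_lt, top_le_iff] at h
  rw [h] at hs
  simp at hs

lemma eLpNorm_piFun_le {φ : ℝ → ℂ} (hφ : StronglyMeasurable φ) :
    eLpNorm (piFun ν f φ) 2 ≤ l1 f * eLpNorm φ 2 := by
  have h2 : ∀ g : ℝ → ℂ, eLpNorm g 2 volume = (∫⁻ s : ℝ, ‖g s‖ₑ ^ 2) ^ (1 / 2 : ℝ) := fun g => by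
    rw [eLpNorm_eq_lintegral_rpow_enorm_toReal (by norm_num) (by norm_num)]; simp
  have e2 : (l1 f ^ 2) ^ (1 / 2 : ℝ) = l1 f := by
    rw [← ENNReal.rpow_natCast, ← ENNReal.rpow_mul]; norm_num
  rw [h2, h2]
  conv_rhs => rw [← e2, ← ENNReal.mul_rpow_of_nonneg _ _ (by norm_num : (0 : ℝ) ≤ 1 / 2),
    ← lintegral_sq_le f hφ]
  refine ENNReal.rpow_le_rpow (lintegral_mono fun s => ?_) (by norm_num)
  refine le_trans (pow_le_pow_left' ?_ 2) (sq_lintegral_le f hφ s)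
  refine (enorm_integral_le_lintegral_enorm _).trans_eq ?_
  simp only [enorm_integrand]

lemma memLp_piFun (φ : Hil) : MemLp (piFun ν f φ) 2 (volume : Measure ℝ) := by
  have h := Lp.stronglyMeasurable φ
  refine ⟨(stronglyMeasurable_piFun ν f h).aestronglyMeasurable, ?_⟩
  exact (eLpNorm_piFun_le ν f h).trans_lt
    (ENNReal.mul_lt_top (l1_ne_top f).lt_top (Lp.memLp φ).2)

lemma piFun_congr {φ ψ : ℝ → ℂ} (h : φ =ᵐ[volume] ψ) : piFun ν f φ = piFun ν f ψ := by
  funext s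
  refine integral_congr_ae ?_
  have hq : Measure.QuasiMeasurePreserving (fun p : ℝ × ℝ => s + p.1) volume volume :=
    (measurePreserving_add_left (volume : Measure ℝ) s).quasiMeasurePreserving.comp
      Measure.quasiMeasurePreserving_fst
  filter_upwards [hq.ae_eq_comp h] with p hp
  have hp' : φ (s + p.1) = ψ (s + p.1) := hp
  simp only [piGroup, hp']

end Boundedness

/-- The bounded operator `π_ν(f)` on `L²(ℝ, ds)`,
`(π_ν(f) φ)(s) = ∫ e^a f(a, b) e^{ν i b e^{-s}} φ(s + a) da db`. -/
def piOp (ν : ℝ) (f : AlgA) : Hil →L[ℂ] Hil :=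
  LinearMap.mkContinuous
    { toFun := fun φ => (memLp_piFun ν f φ).toLp
      map_add' := fun φ ψ => by
        rw [← MemLp.toLp_add, MemLp.toLp_eq_toLp_iff, piFun_congr ν f (Lp.coeFn_add φ ψ)]
        filter_upwards [integrable_integrand ν f (Lp.stronglyMeasurable φ) (Lp.memLp φ),
          integrable_integrand ν f (Lp.stronglyMeasurable ψ) (Lp.memLp ψ)] with s h1 h2
        rw [Pi.add_apply, piFun, piFun, piFun, ← integral_add h1 h2]
        refine integral_congr_ae (Filter.Eventually.of_forall fun p => ?_)
        simp only [piGroup, Pi.add_apply]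
        ring
      map_smul' := fun c φ => by
        simp only [RingHom.id_apply]
        rw [← MemLp.toLp_const_smul, MemLp.toLp_eq_toLp_iff,
          piFun_congr ν f (Lp.coeFn_smul c φ)]
        refine Filter.Eventually.of_forall fun s => ?_
        rw [Pi.smul_apply, piFun, piFun, smul_eq_mul, ← integral_const_mul]
        refine integral_congr_ae (Filter.Eventually.of_forall fun p => ?_)
        simp only [piGroup, Pi.smul_apply, smul_eq_mul]
        ring }
    (l1 f).toReal (fun φ => by
      change ‖(memLp_piFun ν f φ).toLp‖ ≤ _
      rw [Lp.norm_toLp, Lp.norm_def, ← ENNReal.toReal_mul]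
      exact ENNReal.toReal_mono (ENNReal.mul_ne_top (l1_ne_top f) (Lp.memLp φ).2.ne)
        (eLpNorm_piFun_le ν f (Lp.stronglyMeasurable φ)))

lemma piOp_ae (ν : ℝ) (f : AlgA) (φ : Hil) : piOp ν f φ =ᵐ[volume] piFun ν f φ :=
  (memLp_piFun ν f φ).coeFn_toLp

/-! ### The Duflo–Moore operator -/

/-- The Duflo–Moore operator `(θ φ)(s) = e^{-s/2} φ(s)` on its maximal domain
`{φ ∈ L² | e^{-s/2} φ ∈ L²}`. -/
def theta : Hil →ₗ.[ℂ] Hil where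
  domain :=
    { carrier := {φ | MemLp (fun s : ℝ => (Real.exp (-s / 2) : ℂ) * φ s) 2 volume}
      add_mem' := fun {φ ψ} hφ hψ => by
        refine (MemLp.add hφ hψ).ae_eq ?_
        filter_upwards [Lp.coeFn_add φ ψ] with s hs
        simp only [Pi.add_apply, hs, mul_add]
      zero_mem' := by
        refine (MemLp.zero (ε := ℂ)).ae_eq ?_
        refine Filter.Eventually.of_forall fun s => ?_
        simp
      smul_mem' := fun c φ hφ => by
        refine (MemLp.const_smul hφ c).ae_eq ?_
        filter_upwards [Lp.coeFn_smul c φ] with s hs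
        simp only [Pi.smul_apply, hs, smul_eq_mul]
        ring }
  toFun :=
    { toFun := fun φ => MemLp.toLp _ φ.2
      map_add' := fun φ ψ => by
        rw [← MemLp.toLp_add, MemLp.toLp_eq_toLp_iff]
        filter_upwards [Lp.coeFn_add φ.1 ψ.1] with s hs
        simp only [Pi.add_apply, Submodule.coe_add, hs, mul_add]
      map_smul' := fun c φ => by
        simp only [RingHom.id_apply]
        rw [← MemLp.toLp_const_smul, MemLp.toLp_eq_toLp_iff]
        filter_upwards [Lp.coeFn_smul c φ.1] with s hs
        simp only [Pi.smul_apply, Submodule.coe_smul, hs, smul_eq_mul]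
        ring }

/-- `θ²`. -/
def thetaSq : Hil →ₗ.[ℂ] Hil := ucomp theta theta

/-- `π_ν(f) θ²`. -/
def piThetaSq (ν : ℝ) (f : AlgA) : Hil →ₗ.[ℂ] Hil := ucomp (ofBounded (piOp ν f)) thetaSq

/-- `θ π_ν(f) θ`. -/
def thetaPiTheta (ν : ℝ) (f : AlgA) : Hil →ₗ.[ℂ] Hil :=
  ucomp theta (ucomp (ofBounded (piOp ν f)) theta)

/-- `θ² π_ν(f)`. -/
def thetaSqPi (ν : ℝ) (f : AlgA) : Hil →ₗ.[ℂ] Hil := ucomp thetaSq (ofBounded (piOp ν f))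

end KappaAffine

end

open MeasureTheory Set
open scoped ENNReal InnerProductSpace

noncomputable section

/-! Write `f̂(a, β)` for the Fourier transform of `f` in `b`. The operator `π_ν(f)` has kernel
`e^{t-s} f̂(t-s, ν e^{-s})`. Since `∂_b` becomes multiplication by `-iβ`, and `β = ν e^{-s}` in this
kernel, the weight `e^{-s}` can be absorbed into the test function: `e^{-s} π_ν(e^{-a} h) = π_ν(g)`
with `g = iν e^{-a} ∂_b h` (`twist`). Passing a factor `e^{-t}` from right to left only costs a
power of `e^a`. Hence all three products are restrictions of bounded operators `π_ν(twist ν (e^{αa}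
f))`, with `α = 0, 1/2, 1` (`piFun_weight_ae`).

It remains to treat `π_ν(twist ν h)`, whose kernel is `e^{-s} ĥ(t-s, ν e^{-s})`. Inverting `1 + ∂_a`
writes it as `∫ U(s,x) V(x,t) dx`, where `U` is built from `h + ∂_a h` and `V(x,t) = e^{x-t}` for `x
≤ t`, zero otherwise. The operator is thus an integral over `x` of rank one operators whose norms
are integrable, because `U` decays exponentially (`exists_kernel_bound`). Such an operator is trace
class (`isTraceClass_of_nuclear`), and its trace is the integral of the traces of the rank one
pieces (`hasTrace_of_nuclear`), which by Fubini is the integral of the kernel over the diagonal, `∫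
e^{-s} ĥ(0, ν e^{-s}) ds`. The substitution `β = ν e^{-s}` turns this into an integral over a
half-line. On the diagonal `a = 0`, so the factor `e^{αa}` disappears and the three traces agree. -/

namespace KappaAffine

/-! ### Absolutely convergent integrals of rank one operators -/

section Nuclear

variable {H : Type} [NormedAddCommGroup H] [InnerProductSpace ℂ H]

variable {X : Type*} [MeasurableSpace X] {μ : Measure X} {u v : X → H}
  {B : X → ℝ}

lemma integrable_inner_mul_inner
    (hu : ∀ φ, AEStronglyMeasurable (fun x => ⟪φ, u x⟫_ℂ) μ)
    (hv : ∀ φ, AEStronglyMeasurable (fun x => ⟪v x, φ⟫_ℂ) μ)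
    (hB : Integrable B μ) (huv : ∀ x, ‖u x‖ * ‖v x‖ ≤ B x) (φ ψ : H) :
    Integrable (fun x => ⟪φ, u x⟫_ℂ * ⟪v x, ψ⟫_ℂ) μ := by
  refine (hB.const_mul (‖φ‖ * ‖ψ‖)).mono' ((hu φ).mul (hv ψ)) (.of_forall fun x => ?_)
  rw [norm_mul]
  calc _ ≤ (‖φ‖ * ‖u x‖) * (‖v x‖ * ‖ψ‖) :=
        mul_le_mul (norm_inner_le_norm _ _) (norm_inner_le_norm _ _) (norm_nonneg _) (by positivity)
    _ = ‖φ‖ * ‖ψ‖ * (‖u x‖ * ‖v x‖) := by ring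
    _ ≤ _ := by gcongr; exact huv x

/-- Distinct basis vectors are at distance `√2`, so the balls of radius `1/2` around them are
disjoint. Countability is needed to exchange the sum over the basis with an integral. -/
lemma countable_of_hilbertBasis [SecondCountableTopology H] {ι : Type*} (e : HilbertBasis ι ℂ H) :
    Countable ι := by
  refine Pairwise.countable_of_isOpen_disjoint (s := fun i => Metric.ball (e i) (1 / 2)) ?_
    (fun _ => Metric.isOpen_ball) (fun i => ⟨e i, Metric.mem_ball_self (by norm_num)⟩)
  intro i j hij
  refine Metric.ball_disjoint_ball ?_
  have h := norm_sub_sq (𝕜 := ℂ) (e i) (e j)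
  rw [e.orthonormal.1 i, e.orthonormal.1 j, e.orthonormal.2 hij] at h
  norm_num at h
  rw [dist_eq_norm]
  nlinarith [norm_nonneg (e i - e j)]

variable [CompleteSpace H] {T : H →L[ℂ] H}

/-- Approximate polar decomposition. -/
lemma exists_contraction_adjoint_mul_near_abs (T : H →L[ℂ] H) {ε : ℝ} (hε : 0 < ε) :
    ∃ A : H →L[ℂ] H, ‖A‖ ≤ 1 ∧ ‖star A * T - CFC.abs T‖ ≤ ε := by
  set B : H →L[ℂ] H := CFC.abs T with hB
  have hB0 : 0 ≤ B := CFC.abs_nonneg T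
  have hBs : IsSelfAdjoint B := .of_nonneg hB0
  have hBB : B * B = star T * T := CFC.abs_mul_abs T
  -- The contraction is `T (|T| + ε)⁻¹`, which replaces the partial isometry of the polar
  -- decomposition; `|r|` makes the function continuous on all of `ℝ`.
  have hc : Continuous fun r : ℝ => (|r| + ε)⁻¹ :=
    (continuous_abs.add continuous_const).inv₀ fun r => (by positivity : 0 < |r| + ε).ne'
  set h : H →L[ℂ] H := cfc (fun r : ℝ => (|r| + ε)⁻¹) B with hh
  have hhs : IsSelfAdjoint h := cfc_predicate _ B
  have hid : B = cfc (fun r : ℝ => r) B := (cfc_id' ℝ B).symm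
  have hBB' : B * B = cfc (fun r : ℝ => r * r) B := by
    rw [cfc_mul (fun r : ℝ => r) (fun r : ℝ => r) B, ← hid]
  have hhBB : h * (B * B) = cfc (fun r : ℝ => (|r| + ε)⁻¹ * (r * r)) B := by
    rw [hBB', hh, ← cfc_mul _ _ B hc.continuousOn (by fun_prop)]
  have hhBBh : h * (B * B) * h = cfc (fun r : ℝ => (|r| + ε)⁻¹ * (r * r) * (|r| + ε)⁻¹) B := by
    rw [hhBB, hh, ← cfc_mul _ _ B (by fun_prop) hc.continuousOn]
  refine ⟨T * h, ?_, ?_⟩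
  · have h1 : ‖star (T * h) * (T * h)‖ ≤ 1 := by
      have : star (T * h) * (T * h) = h * (B * B) * h := by
        rw [star_mul, hhs.star_eq, hBB]; simp only [mul_assoc]
      rw [this, hhBBh]
      refine norm_cfc_le zero_le_one fun r _ => ?_
      have hp : 0 < |r| + ε := by positivity
      rw [Real.norm_eq_abs, abs_mul, abs_mul, abs_mul, abs_inv, abs_of_pos hp]
      have : |r| * (|r| + ε)⁻¹ ≤ 1 := by
        rw [← div_eq_mul_inv, div_le_one hp]; linarith
      calc (|r| + ε)⁻¹ * (|r| * |r|) * (|r| + ε)⁻¹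
          = (|r| * (|r| + ε)⁻¹) * (|r| * (|r| + ε)⁻¹) := by ring
        _ ≤ 1 := mul_le_one₀ this (by positivity) this
    rw [CStarRing.norm_star_mul_self] at h1
    nlinarith [norm_nonneg (T * h)]
  · have : star (T * h) * T - B = cfc (fun r : ℝ => (|r| + ε)⁻¹ * (r * r) - r) B := by
      rw [star_mul, hhs.star_eq, mul_assoc, ← hBB, hhBB,
        cfc_sub _ _ B (by fun_prop) (by fun_prop), ← hid]
    rw [this]
    refine norm_cfc_le hε.le fun r hr => ?_
    have hr0 : 0 ≤ r := spectrum_nonneg_of_nonneg hB0 hr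
    have hp : 0 < r + ε := by positivity
    have e : (|r| + ε)⁻¹ * (r * r) - r = -(ε * (r / (r + ε))) := by
      rw [abs_of_nonneg hr0]; field_simp; ring
    rw [e, norm_neg, Real.norm_of_nonneg (by positivity)]
    exact mul_le_of_le_one_right hε.le ((div_le_one hp).2 (by linarith))

/-- Bessel's inequality for `A* x` and for `y`, then Cauchy–Schwarz. -/
lemma sum_norm_inner_mul_inner_le {ι : Type*} {e : ι → H} (he : Orthonormal ℂ e)
    (A : H →L[ℂ] H) (hA : ‖A‖ ≤ 1) (F : Finset ι) (x y : H) :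
    ∑ i ∈ F, ‖⟪A (e i), x⟫_ℂ * ⟪y, e i⟫_ℂ‖ ≤ ‖x‖ * ‖y‖ := by
  have hb : ∀ z : H, ∑ i ∈ F, ‖⟪e i, z⟫_ℂ‖ ^ 2 ≤ ‖z‖ ^ 2 := fun z =>
    he.sum_inner_products_le z
  have h1 : ∑ i ∈ F, ‖⟪A (e i), x⟫_ℂ‖ ^ 2 ≤ ‖x‖ ^ 2 := by
    have := hb (ContinuousLinearMap.adjoint A x)
    simp only [ContinuousLinearMap.adjoint_inner_right] at this
    refine this.trans ?_
    gcongr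
    refine (ContinuousLinearMap.le_opNorm _ _).trans (mul_le_of_le_one_left (norm_nonneg _) ?_)
    rwa [LinearIsometryEquiv.norm_map]
  have h2 : ∑ i ∈ F, ‖⟪y, e i⟫_ℂ‖ ^ 2 ≤ ‖y‖ ^ 2 := by
    simpa only [norm_inner_symm] using hb y
  simp only [norm_mul]
  refine le_of_sq_le_sq ?_ (by positivity)
  refine (Finset.sum_mul_sq_le_sq_mul_sq _ _ _).trans ?_
  rw [mul_pow]
  exact mul_le_mul h1 h2 (by positivity) (by positivity)

lemma sum_integral_norm_inner_mul_inner_le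
    (hu : ∀ φ, AEStronglyMeasurable (fun x => ⟪φ, u x⟫_ℂ) μ)
    (hv : ∀ φ, AEStronglyMeasurable (fun x => ⟪v x, φ⟫_ℂ) μ)
    (hB : Integrable B μ) (huv : ∀ x, ‖u x‖ * ‖v x‖ ≤ B x)
    {ι : Type*} {e : ι → H} (he : Orthonormal ℂ e)
    (A : H →L[ℂ] H) (hA : ‖A‖ ≤ 1) (F : Finset ι) :
    ∑ i ∈ F, ∫ x, ‖⟪A (e i), u x⟫_ℂ * ⟪v x, e i⟫_ℂ‖ ∂μ ≤ ∫ x, B x ∂μ := by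
  have hi := integrable_inner_mul_inner hu hv hB huv
  rw [← integral_finsetSum _ fun i _ => (hi (A (e i)) (e i)).norm]
  exact integral_mono (integrable_finsetSum _ fun i _ => (hi _ _).norm) hB fun x =>
    (sum_norm_inner_mul_inner_le he A hA F (u x) (v x)).trans (huv x)

/-- An absolutely convergent integral of rank one operators is trace class. -/
lemma isTraceClass_of_nuclear
    (hT : ∀ φ ψ, ⟪φ, T ψ⟫_ℂ = ∫ x, ⟪φ, u x⟫_ℂ * ⟪v x, ψ⟫_ℂ ∂μ)
    (hu : ∀ φ, AEStronglyMeasurable (fun x => ⟪φ, u x⟫_ℂ) μ)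
    (hv : ∀ φ, AEStronglyMeasurable (fun x => ⟪v x, φ⟫_ℂ) μ)
    (hB : Integrable B μ) (huv : ∀ x, ‖u x‖ * ‖v x‖ ≤ B x) : IsTraceClass T := by
  intro ι e
  have hpos : ∀ i, 0 ≤ (⟪e i, CFC.abs T (e i)⟫_ℂ).re := fun i =>
    ((ContinuousLinearMap.nonneg_iff_isPositive _).1 (CFC.abs_nonneg T)).re_inner_nonneg_right _
  refine summable_of_sum_le hpos (c := ∫ x, B x ∂μ) fun F => ?_
  refine le_of_forall_pos_le_add fun δ hδ => ?_
  -- The tolerance is chosen so that the errors over `F` add up to at most `δ`; the `+ 1` covers the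
  -- empty set.
  obtain ⟨A, hA, hAT⟩ := exists_contraction_adjoint_mul_near_abs T
    (show 0 < δ / (F.card + 1) by positivity)
  have hterm : ∀ i, (⟪e i, CFC.abs T (e i)⟫_ℂ).re
      ≤ (∫ x, ‖⟪A (e i), u x⟫_ℂ * ⟪v x, e i⟫_ℂ‖ ∂μ) + δ / (F.card + 1) := fun i => by
    have h1 : ‖⟪e i, (star A * T - CFC.abs T) (e i)⟫_ℂ‖ ≤ δ / (F.card + 1) := by
      refine (norm_inner_le_norm _ _).trans ?_
      rw [e.orthonormal.1 i, one_mul]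
      exact ((ContinuousLinearMap.le_opNorm _ _).trans_eq (by rw [e.orthonormal.1 i, mul_one])).trans
        hAT
    have h2 : ⟪e i, (star A * T - CFC.abs T) (e i)⟫_ℂ
        = ⟪A (e i), T (e i)⟫_ℂ - ⟪e i, CFC.abs T (e i)⟫_ℂ := by
      rw [sub_apply, inner_sub_right, mul_apply_eq_comp,
        ContinuousLinearMap.star_eq_adjoint, ContinuousLinearMap.adjoint_inner_right]
    have h3 : ‖⟪A (e i), T (e i)⟫_ℂ‖ ≤ ∫ x, ‖⟪A (e i), u x⟫_ℂ * ⟪v x, e i⟫_ℂ‖ ∂μ := by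
      rw [hT]; exact norm_integral_le_integral_norm _
    rw [h2] at h1
    have h4 := (Complex.abs_re_le_norm _).trans h1
    have h5 := (Complex.re_le_norm _).trans h3
    rw [Complex.sub_re] at h4
    have := (abs_le.1 h4).1
    linarith
  calc _ ≤ ∑ i ∈ F, ((∫ x, ‖⟪A (e i), u x⟫_ℂ * ⟪v x, e i⟫_ℂ‖ ∂μ) + δ / (F.card + 1)) :=
        Finset.sum_le_sum fun i _ => hterm i
    _ ≤ _ := by
      rw [Finset.sum_add_distrib, Finset.sum_const, nsmul_eq_mul]
      refine add_le_add
        (sum_integral_norm_inner_mul_inner_le hu hv hB huv e.orthonormal A hA F) ?_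
      rw [mul_div_assoc', div_le_iff₀ (by positivity)]
      nlinarith

/-- The bound on finite sums allows summation under the integral, where Parseval's identity
evaluates the series at each `x`. -/
lemma hasTrace_of_nuclear [SecondCountableTopology H]
    (hT : ∀ φ ψ, ⟪φ, T ψ⟫_ℂ = ∫ x, ⟪φ, u x⟫_ℂ * ⟪v x, ψ⟫_ℂ ∂μ)
    (hu : ∀ φ, AEStronglyMeasurable (fun x => ⟪φ, u x⟫_ℂ) μ)
    (hv : ∀ φ, AEStronglyMeasurable (fun x => ⟪v x, φ⟫_ℂ) μ)
    (hB : Integrable B μ) (huv : ∀ x, ‖u x‖ * ‖v x‖ ≤ B x) :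
    HasTrace T (∫ x, ⟪v x, u x⟫_ℂ ∂μ) := by
  intro ι e
  have := countable_of_hilbertBasis e
  have hs : Summable fun i => ∫ x, ‖⟪e i, u x⟫_ℂ * ⟪v x, e i⟫_ℂ‖ ∂μ :=
    summable_of_sum_le (fun i => integral_nonneg fun x => norm_nonneg _) fun F => by
      simpa using sum_integral_norm_inner_mul_inner_le hu hv hB huv e.orthonormal
        (ContinuousLinearMap.id ℂ H) ContinuousLinearMap.norm_id_le F
  have := hasSum_integral_of_summable_integral_norm
    (fun i => integrable_inner_mul_inner hu hv hB huv (e i) (e i)) hs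
  simp only [← hT] at this
  have h : ∀ x, ∑' i, ⟪e i, u x⟫_ℂ * ⟪v x, e i⟫_ℂ = ⟪v x, u x⟫_ℂ := fun x => by
    simpa only [mul_comm] using e.tsum_inner_mul_inner (v x) (u x)
  simpa only [h] using this

end Nuclear

/-! ### Operations on test functions and the partial Fourier transform -/

/-- Multiplication of a test function by `e^{c a}`. -/
def expMul (c : ℝ) (f : AlgA) : AlgA where
  toFun p := (Real.exp (c * p.1) : ℂ) * f p
  contDiff' := by
    have h : ContDiff ℝ (⊤ : ℕ∞) fun p : ℝ × ℝ => (Real.exp (c * p.1) : ℂ) :=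
      Complex.ofRealCLM.contDiff.comp (g := fun x : ℝ => (x : ℂ))
        (f := fun p : ℝ × ℝ => Real.exp (c * p.1)) (by fun_prop)
    exact h.mul f.contDiff
  hasCompactSupport' := f.hasCompactSupport.mul_left
  tsupport_subset' := subset_univ _

/-- The directional derivative of a test function. -/
def dirDeriv (w : ℝ × ℝ) (f : AlgA) : AlgA where
  toFun p := fderiv ℝ f p w
  contDiff' := (f.contDiff.fderiv_right (m := (⊤ : ℕ∞)) (by simp)).clm_apply contDiff_const
  hasCompactSupport' := f.hasCompactSupport.fderiv_apply ℝ w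
  tsupport_subset' := subset_univ _

@[simp] lemma expMul_apply (c : ℝ) (f : AlgA) (p : ℝ × ℝ) :
    expMul c f p = (Real.exp (c * p.1) : ℂ) * f p := rfl

lemma differentiable_testFunction (f : AlgA) : Differentiable ℝ f :=
  f.contDiff.differentiable (by simp)

lemma hasDerivAt_fst (f : AlgA) (a b : ℝ) :
    HasDerivAt (fun a => f (a, b)) (dirDeriv (1, 0) f (a, b)) a :=
  ((differentiable_testFunction f (a, b)).hasFDerivAt).comp_hasDerivAt a
    ((hasDerivAt_id a).prodMk (hasDerivAt_const a b))

lemma hasDerivAt_snd (f : AlgA) (a b : ℝ) :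
    HasDerivAt (fun b => f (a, b)) (dirDeriv (0, 1) f (a, b)) b :=
  ((differentiable_testFunction f (a, b)).hasFDerivAt).comp_hasDerivAt b
    ((hasDerivAt_const b a).prodMk (hasDerivAt_id b))

lemma hasCompactSupport_fst (f : AlgA) (b : ℝ) : HasCompactSupport fun a => f (a, b) :=
  .intro (f.hasCompactSupport.isCompact.image continuous_fst) fun _ ha =>
    image_eq_zero_of_notMem_tsupport fun h => ha ⟨_, h, rfl⟩

lemma hasCompactSupport_snd (f : AlgA) (a : ℝ) : HasCompactSupport fun b => f (a, b) :=
  .intro (f.hasCompactSupport.isCompact.image continuous_snd) fun _ hb =>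
    image_eq_zero_of_notMem_tsupport fun h => hb ⟨_, h, rfl⟩

/-- The partial Fourier transform `∫ f(a, b) e^{i b β} db`. -/
def hat (f : AlgA) (a β : ℝ) : ℂ := ∫ b : ℝ, f (a, b) * Complex.exp (Complex.I * b * β)

lemma norm_exp_I_mul_mul (b β : ℝ) : ‖Complex.exp (Complex.I * b * β)‖ = 1 := by
  rw [show Complex.I * b * β = ((b * β : ℝ) : ℂ) * Complex.I by push_cast; ring]
  exact Complex.norm_exp_ofReal_mul_I _

lemma integrable_hat (f : AlgA) (a β : ℝ) :
    Integrable fun b : ℝ => f (a, b) * Complex.exp (Complex.I * b * β) := by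
  have : Continuous fun b : ℝ => f (a, b) * Complex.exp (Complex.I * b * β) := by
    have := f.continuous
    fun_prop
  exact this.integrable_of_hasCompactSupport (hasCompactSupport_snd f a).mul_right

lemma stronglyMeasurable_hat (f : AlgA) : StronglyMeasurable fun q : ℝ × ℝ => hat f q.1 q.2 := by
  have : Continuous fun q : (ℝ × ℝ) × ℝ =>
      f (q.1.1, q.2) * Complex.exp (Complex.I * q.2 * q.1.2) := by
    have := f.continuous
    fun_prop
  exact this.stronglyMeasurable.integral_prod_right

lemma hat_dirDeriv_snd (f : AlgA) (a β : ℝ) :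
    hat (dirDeriv (0, 1) f) a β = -(Complex.I * β) * hat f a β := by
  have hd : ∀ b : ℝ, HasDerivAt (fun b : ℝ => Complex.exp (Complex.I * b * β))
      (Complex.exp (Complex.I * b * β) * (Complex.I * β)) b := fun b => by
    have h : HasDerivAt (fun b : ℝ => Complex.I * (b : ℂ) * β) (Complex.I * 1 * β) b :=
      ((hasDerivAt_id b).ofReal_comp.const_mul Complex.I).mul_const (β : ℂ)
    simpa using h.cexp
  have h := integral_mul_deriv_eq_deriv_mul_of_integrable (fun b _ => hasDerivAt_snd f a b)
    (fun b _ => hd b)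
    (by
      refine ((integrable_hat f a β).mul_const (Complex.I * β)).congr (.of_forall fun b => ?_)
      simp only [Pi.mul_apply]; ring)
    (integrable_hat (dirDeriv (0, 1) f) a β) (integrable_hat f a β)
  rw [hat, hat, ← neg_eq_iff_eq_neg.2 h, ← integral_const_mul, ← integral_neg]
  congr 1; funext b; ring

/-- The partial Fourier transform decays quadratically and has bounded support in `a`. -/
lemma exists_hat_bound (f : AlgA) : ∃ C R : ℝ, 0 ≤ C ∧ 0 ≤ R ∧
    ∀ a β, (1 + β ^ 2) * ‖hat f a β‖ ≤ C ∧ (R < |a| → hat f a β = 0) := by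
  have key : ∀ g : AlgA, ∃ C, ∀ a β, ‖hat g a β‖ ≤ C := fun g => by
    obtain ⟨M, hM⟩ := g.hasCompactSupport.exists_bound_of_continuous g.continuous
    obtain ⟨R, hR⟩ := g.hasCompactSupport.isCompact.isBounded.exists_norm_le
    refine ⟨M * (volume (Icc (-R) R)).toReal, fun a β => ?_⟩
    have hz : ∀ b ∉ Icc (-R) R, g (a, b) * Complex.exp (Complex.I * b * β) = 0 := fun b hb => by
      have : g (a, b) = 0 := image_eq_zero_of_notMem_tsupport fun h =>
        hb (abs_le.1 ((norm_snd_le (a, b)).trans (hR _ h)))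
      rw [this, zero_mul]
    rw [hat, ← setIntegral_eq_integral_of_forall_compl_eq_zero hz]
    refine norm_setIntegral_le_of_norm_le_const (by simp) fun b _ => ?_
    rw [norm_mul, norm_exp_I_mul_mul, mul_one]
    exact hM _
  obtain ⟨C₀, h₀⟩ := key f
  -- Two derivatives in `b` multiply the transform by `-β²`, which supplies the quadratic decay.
  obtain ⟨C₂, h₂⟩ := key (dirDeriv (0, 1) (dirDeriv (0, 1) f))
  obtain ⟨R, hR⟩ := f.hasCompactSupport.isCompact.isBounded.exists_norm_le
  refine ⟨C₀ + C₂, |R|, ?_, abs_nonneg R, fun a β => ⟨?_, fun ha => ?_⟩⟩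
  · exact add_nonneg ((norm_nonneg _).trans (h₀ 0 0)) ((norm_nonneg _).trans (h₂ 0 0))
  · have := h₂ a β
    rw [hat_dirDeriv_snd, hat_dirDeriv_snd] at this
    simp only [norm_mul, norm_neg, Complex.norm_I, one_mul, Complex.norm_real,
      Real.norm_eq_abs, ← mul_assoc, abs_mul_abs_self] at this
    linarith [h₀ a β, sq β]
  · have : ∀ b, f (a, b) = 0 := fun b => image_eq_zero_of_notMem_tsupport fun h =>
      absurd ((norm_fst_le (a, b)).trans (hR _ h)) (not_le.2 ((le_abs_self R).trans_lt ha))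
    simp [hat, this]

/-- The integrand is the `y`-derivative of `e^{y-a} f(y, b)`, which vanishes near `-∞`. -/
lemma integral_Iic_exp_mul (f : AlgA) (a b : ℝ) :
    ∫ y in Iic a, (Real.exp (y - a) : ℂ) * (f + dirDeriv (1, 0) f) (y, b) = f (a, b) := by
  have hcs : HasCompactSupport fun y => (Real.exp (y - a) : ℂ) * f (y, b) :=
    (hasCompactSupport_fst f b).mul_left
  have hd : ∀ y : ℝ, HasDerivAt (fun y : ℝ => (Real.exp (y - a) : ℂ) * f (y, b))
      ((Real.exp (y - a) : ℂ) * (f + dirDeriv (1, 0) f) (y, b)) y := fun y => by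
    have h1 : HasDerivAt (fun y : ℝ => (Real.exp (y - a) : ℂ)) (Real.exp (y - a) : ℂ) y := by
      simpa using (((hasDerivAt_id y).sub_const a).exp).ofReal_comp
    rw [add_apply, mul_add]
    exact h1.mul (hasDerivAt_fst f y b)
  have hc : ContDiff ℝ 1 fun y : ℝ => (Real.exp (y - a) : ℂ) * f (y, b) := by
    have h1 : ContDiff ℝ 1 fun y : ℝ => (Real.exp (y - a) : ℂ) :=
      Complex.ofRealCLM.contDiff.comp (g := fun x : ℝ => (x : ℂ))
        (f := fun y : ℝ => Real.exp (y - a)) (by fun_prop)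
    exact h1.mul ((f.contDiff.of_le (by simp)).comp (contDiff_id.prodMk contDiff_const))
  have := hcs.integral_Iic_deriv_eq hc a
  simp only [fun y => (hd y).deriv] at this
  simpa using this

lemma hat_eq_integral_Iic (f : AlgA) (a β : ℝ) :
    hat f a β = ∫ y in Iic a, (Real.exp (y - a) : ℂ) * hat (f + dirDeriv (1, 0) f) y β := by
  set k := f + dirDeriv (1, 0) f with hk
  have hi : Integrable (fun q : ℝ × ℝ => (Real.exp (q.1 - a) : ℂ) *
      (k q * Complex.exp (Complex.I * q.2 * β)))
      ((volume.restrict (Iic a)).prod volume) := by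
    have h1 : Continuous fun q : ℝ × ℝ => (Real.exp (q.1 - a) : ℂ) *
      (k q * Complex.exp (Complex.I * q.2 * β)) := by
      have := k.continuous
      fun_prop
    have h2 := h1.integrable_of_hasCompactSupport (μ := volume)
      (k.hasCompactSupport.mul_right.mul_left)
    have e : (volume.restrict (Iic a)).prod (volume : Measure ℝ)
        = (volume : Measure (ℝ × ℝ)).restrict (Iic a ×ˢ univ) := by
      rw [Measure.volume_eq_prod, ← Measure.prod_restrict, Measure.restrict_univ]
    rw [e]
    exact h2.integrableOn
  simp only [hat, ← integral_const_mul]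
  rw [integral_integral_swap hi]
  congr 1; funext b
  rw [← integral_Iic_exp_mul f a b, ← integral_mul_const]
  simp only [mul_assoc, hk]

/-! ### The integrated representation as an integral operator -/

lemma piFun_eq_integral_hat (ν : ℝ) (f : AlgA) (φ : ℝ → ℂ) (s : ℝ)
    (h : Integrable fun p : ℝ × ℝ => (Real.exp p.1 : ℂ) * f p * piGroup ν p φ s) :
    piFun ν f φ s = ∫ a : ℝ, (Real.exp a : ℂ) * hat f a (ν * Real.exp (-s)) * φ (s + a) := by
  rw [piFun, Measure.volume_eq_prod, integral_prod _ h]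
  congr 1; funext a
  rw [hat, ← integral_const_mul, ← integral_mul_const]
  congr 1; funext b
  simp only [piGroup, Complex.ofReal_mul]
  rw [show (ν * Complex.I * b * Real.exp (-s) : ℂ) = Complex.I * b * (ν * Real.exp (-s)) by ring]
  ring

/-- The test function `g = i ν e^{-a} ∂_b h`, for which `π_ν(g) = e^{-s} π_ν(e^{-a} h)`. -/
def twist (ν : ℝ) (h : AlgA) : AlgA := (Complex.I * ν) • expMul (-1) (dirDeriv (0, 1) h)

lemma hat_expMul (c : ℝ) (f : AlgA) (a β : ℝ) :
    hat (expMul c f) a β = (Real.exp (c * a) : ℂ) * hat f a β := by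
  simp only [hat, expMul_apply, mul_assoc, integral_const_mul]

lemma hat_smul (c : ℂ) (f : AlgA) (a β : ℝ) : hat (c • f) a β = c * hat f a β := by
  simp only [hat, smul_apply, smul_eq_mul, mul_assoc, integral_const_mul]

/-- At `β = ν e^{-s}` the product of `iν` and `-iβ` is `ν² e^{-s} = e^{-s}`. -/
lemma hat_twist {ν : ℝ} (hν : ν * ν = 1) (h : AlgA) (a s : ℝ) :
    (Real.exp a : ℂ) * hat (twist ν h) a (ν * Real.exp (-s))
      = (Real.exp (-s) : ℂ) * hat h a (ν * Real.exp (-s)) := by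
  have hν' : (ν : ℂ) * ν = 1 := by exact_mod_cast hν
  have he : (Real.exp a : ℂ) * Real.exp (-1 * a) = 1 := by
    rw [← Complex.ofReal_mul, ← Real.exp_add]; simp
  rw [twist, hat_smul, hat_expMul, hat_dirDeriv_snd]
  push_cast at he ⊢
  linear_combination (-(Complex.I ^ 2) * ν * ν * Complex.exp (-s) * hat h a (ν * Real.exp (-s))) * he
    - (Complex.I ^ 2) * Complex.exp (-s) * hat h a (ν * Real.exp (-s)) * hν'
    - Complex.exp (-s) * hat h a (ν * Real.exp (-s)) * Complex.I_sq

lemma piFun_twist_ae {ν : ℝ} (hν : ν * ν = 1) (h : AlgA) (φ : Hil) :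
    ∀ᵐ s : ℝ, piFun ν (twist ν h) φ s
      = (Real.exp (-s) : ℂ) * ∫ a : ℝ, hat h a (ν * Real.exp (-s)) * φ (s + a) := by
  filter_upwards [integrable_integrand ν (twist ν h) (Lp.stronglyMeasurable φ) (Lp.memLp φ)]
    with s hs
  rw [piFun_eq_integral_hat _ _ _ _ hs, ← integral_const_mul]
  simp only [hat_twist hν, mul_assoc]

lemma piFun_twist_expMul_ae {ν : ℝ} (hν : ν * ν = 1) (h : AlgA) (φ : Hil) :
    ∀ᵐ s : ℝ, piFun ν (twist ν h) φ s = (Real.exp (-s) : ℂ) * piFun ν (expMul (-1) h) φ s := by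
  filter_upwards [piFun_twist_ae hν h φ,
    integrable_integrand ν (expMul (-1) h) (Lp.stronglyMeasurable φ) (Lp.memLp φ)] with s h1 h2
  rw [h1, piFun_eq_integral_hat _ _ _ _ h2]
  congr 2; funext a
  rw [hat_expMul, ← mul_assoc, ← Complex.ofReal_mul, ← Real.exp_add]
  simp

/-! ### Products of two weighted Hilbert–Schmidt kernels -/

section Kernels

variable {U V : ℝ → ℝ → ℂ} {w : ℝ → ℝ} {D : ℝ}

/-- In the product of the two bounds the powers of `w x` combine to a single `w x`, leaving the
integrable majorant `D w(s) w(x) w(t) |φ t|`. -/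
lemma integrable_kernel_mul (hU : StronglyMeasurable fun q : ℝ × ℝ => U q.1 q.2)
    (hV : StronglyMeasurable fun q : ℝ × ℝ => V q.1 q.2)
    (hw : Integrable w) (hw0 : ∀ x, 0 < w x)
    (hUb : ∀ s x, ‖U s x‖ ≤ D * w x ^ 2 * w s) (hVb : ∀ x t, ‖V x t‖ ≤ (w x)⁻¹ * w t)
    {φ : ℝ → ℂ} (hφ : Integrable fun t => (w t : ℂ) * φ t) (hφm : StronglyMeasurable φ) (s : ℝ) :
    Integrable fun q : ℝ × ℝ => U s q.2 * V q.2 q.1 * φ q.1 := by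
  have hb := (hφ.norm.mul_prod hw).const_mul (D * w s)
  refine hb.mono' ?_ (.of_forall fun q => ?_)
  · exact (((hU.comp_measurable (measurable_const.prodMk measurable_snd)).mul
      (hV.comp_measurable measurable_swap)).mul
      (hφm.comp_measurable measurable_fst)).aestronglyMeasurable
  · have h0 := hw0 q.2
    have h1 : ‖U s q.2‖ * ‖V q.2 q.1‖ ≤ D * w q.2 ^ 2 * w s * ((w q.2)⁻¹ * w q.1) :=
      mul_le_mul (hUb _ _) (hVb _ _) (norm_nonneg _) ((norm_nonneg _).trans (hUb _ _))
    rw [norm_mul, norm_mul, norm_mul, Complex.norm_real, Real.norm_of_nonneg (hw0 _).le]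
    calc _ ≤ D * w q.2 ^ 2 * w s * ((w q.2)⁻¹ * w q.1) * ‖φ q.1‖ := by gcongr
      _ = _ := by field_simp

/-- The rank one pieces are built from `u_x = U(·, x)` and `v_x`, the conjugate of `V(x, ·)`. The
factor `w(x)²` in the bound on `U` pays for the growth `w(x)⁻¹` allowed to `V`, so `‖u_x‖ ‖v_x‖` is
at most a constant times `w(x)`. -/
lemma isTraceClass_hasTrace_of_kernel (hU : StronglyMeasurable fun q : ℝ × ℝ => U q.1 q.2)
    (hV : StronglyMeasurable fun q : ℝ × ℝ => V q.1 q.2)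
    (hw : Integrable w) (hw2 : MemLp w 2) (hw0 : ∀ x, 0 < w x)
    (hUb : ∀ s x, ‖U s x‖ ≤ D * w x ^ 2 * w s) (hVb : ∀ x t, ‖V x t‖ ≤ (w x)⁻¹ * w t)
    {T : Hil →L[ℂ] Hil}
    (hT : ∀ ψ : Hil, ∀ᵐ s : ℝ, T ψ s = ∫ t : ℝ, (∫ x : ℝ, U s x * V x t) * ψ t) :
    IsTraceClass T ∧ HasTrace T (∫ s : ℝ, ∫ x : ℝ, U s x * V x s) ∧
      Integrable fun s : ℝ => ∫ x : ℝ, U s x * V x s := by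
  have hUx : ∀ x, StronglyMeasurable fun s => U s x := fun x =>
    hU.comp_measurable measurable_prodMk_right
  have hVx : ∀ x, StronglyMeasurable fun t => V x t := fun x =>
    hV.comp_measurable measurable_prodMk_left
  have hu : ∀ x, MemLp (fun s => U s x) 2 := fun x =>
    hw2.of_le_mul (c := D * w x ^ 2) (hUx x).aestronglyMeasurable (.of_forall fun s => by
      rw [Real.norm_of_nonneg (hw0 s).le]; exact hUb s x)
  have hv : ∀ x, MemLp (fun t => star (V x t)) 2 := fun x =>
    hw2.of_le_mul (c := (w x)⁻¹) (hVx x).star.aestronglyMeasurable (.of_forall fun t => by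
      rw [Real.norm_of_nonneg (hw0 t).le, norm_star]; exact hVb x t)
  set M : ℝ := ‖hw2.toLp‖ with hM
  have hun : ∀ x, ‖(hu x).toLp‖ ≤ D * w x ^ 2 * M := fun x => by
    refine Lp.norm_le_mul_norm_of_ae_le_mul ?_
    filter_upwards [(hu x).coeFn_toLp, hw2.coeFn_toLp] with s h1 h2
    rw [h1, h2, Real.norm_of_nonneg (hw0 s).le]; exact hUb s x
  have hvn : ∀ x, ‖(hv x).toLp‖ ≤ (w x)⁻¹ * M := fun x => by
    refine Lp.norm_le_mul_norm_of_ae_le_mul ?_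
    filter_upwards [(hv x).coeFn_toLp, hw2.coeFn_toLp] with s h1 h2
    rw [h1, h2, Real.norm_of_nonneg (hw0 s).le, norm_star]; exact hVb x s
  have hiu : ∀ (φ : Hil) x, ⟪φ, (hu x).toLp⟫_ℂ = ∫ s, U s x * star (φ s) := fun φ x => by
    rw [L2.inner_def]
    refine integral_congr_ae ?_
    filter_upwards [(hu x).coeFn_toLp] with s h1
    rw [h1]; rfl
  have hiv : ∀ (ψ : Hil) x, ⟪(hv x).toLp, ψ⟫_ℂ = ∫ t, V x t * ψ t := fun ψ x => by
    rw [L2.inner_def]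
    refine integral_congr_ae ?_
    filter_upwards [(hv x).coeFn_toLp] with s h1
    rw [h1, RCLike.inner_apply, mul_comm]; simp
  have hmu : ∀ φ : Hil, AEStronglyMeasurable (fun x => ⟪φ, (hu x).toLp⟫_ℂ) volume := fun φ => by
    simp only [hiu]
    exact ((hU.comp_measurable measurable_swap).mul
      ((Lp.stronglyMeasurable φ).comp_measurable
        measurable_snd).star).integral_prod_right.aestronglyMeasurable
  have hmv : ∀ φ : Hil, AEStronglyMeasurable (fun x => ⟪(hv x).toLp, φ⟫_ℂ) volume := fun φ => by
    simp only [hiv]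
    exact (hV.mul ((Lp.stronglyMeasurable φ).comp_measurable
        measurable_snd)).integral_prod_right.aestronglyMeasurable
  have huv : ∀ x, ‖(hu x).toLp‖ * ‖(hv x).toLp‖ ≤ D * M ^ 2 * w x := fun x => by
    have h0 := hw0 x
    calc _ ≤ (D * w x ^ 2 * M) * ((w x)⁻¹ * M) :=
          mul_le_mul (hun x) (hvn x) (norm_nonneg _) ((norm_nonneg _).trans (hun x))
      _ = _ := by field_simp
  have hwφ : ∀ φ : Hil, Integrable fun t => (w t : ℂ) * φ t := fun φ =>
    MemLp.integrable_mul (p := 2) (q := 2) hw2.ofReal (Lp.memLp φ)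
  have hform : ∀ φ ψ : Hil, ⟪φ, T ψ⟫_ℂ
      = ∫ x, ⟪φ, (hu x).toLp⟫_ℂ * ⟪(hv x).toLp, ψ⟫_ℂ := fun φ ψ => by
    have h1 : ∀ᵐ s : ℝ, T ψ s = ∫ x, U s x * ⟪(hv x).toLp, ψ⟫_ℂ := by
      filter_upwards [hT ψ] with s hs
      simp only [hs, hiv, ← integral_const_mul, ← integral_mul_const]
      rw [integral_integral_swap (integrable_kernel_mul hU hV hw hw0 hUb hVb (hwφ ψ)
        (Lp.stronglyMeasurable ψ) s)]
      simp only [mul_assoc]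
    have hint : Integrable fun q : ℝ × ℝ =>
        U q.1 q.2 * ⟪(hv q.2).toLp, ψ⟫_ℂ * star (φ q.1) := by
      refine (((hwφ φ).norm.mul_prod hw).const_mul (D * (M * ‖ψ‖))).mono' ?_
        (.of_forall fun q => ?_)
      · refine (hU.aestronglyMeasurable.mul ?_).mul ?_
        · exact (hmv ψ).comp_quasiMeasurePreserving Measure.quasiMeasurePreserving_snd
        · exact ((Lp.stronglyMeasurable φ).comp_measurable measurable_fst).star.aestronglyMeasurable
      · have h0 := hw0 q.2
        have h2 : ‖⟪(hv q.2).toLp, ψ⟫_ℂ‖ ≤ (w q.2)⁻¹ * M * ‖ψ‖ :=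
          (norm_inner_le_norm _ _).trans (by gcongr; exact hvn _)
        rw [norm_mul, norm_mul, norm_mul, norm_star, Complex.norm_real,
          Real.norm_of_nonneg (hw0 _).le]
        calc _ ≤ (D * w q.2 ^ 2 * w q.1) * ((w q.2)⁻¹ * M * ‖ψ‖) * ‖φ q.1‖ := by
              gcongr
              · exact (norm_nonneg _).trans (hUb _ _)
              · exact hUb _ _
          _ = _ := by field_simp
    rw [L2.inner_def]
    calc _ = ∫ s, ∫ x, U s x * ⟪(hv x).toLp, ψ⟫_ℂ * star (φ s) := by
          refine integral_congr_ae ?_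
          filter_upwards [h1] with s hs
          rw [hs, RCLike.inner_apply, ← integral_mul_const]; rfl
      _ = _ := by
          rw [integral_integral_swap hint]
          congr 1; funext x
          rw [hiu, ← integral_mul_const]
          congr 1; funext s; ring
  have hdiag : Integrable fun q : ℝ × ℝ => U q.1 q.2 * V q.2 q.1 := by
    have hww : Integrable fun s => w s * w s := hw2.integrable_mul hw2
    refine ((hww.mul_prod hw).const_mul D).mono' ?_ (.of_forall fun q => ?_)
    · exact (hU.mul (hV.comp_measurable measurable_swap)).aestronglyMeasurable
    · have h0 := hw0 q.2
      rw [norm_mul]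
      calc _ ≤ D * w q.2 ^ 2 * w q.1 * ((w q.2)⁻¹ * w q.1) :=
            mul_le_mul (hUb _ _) (hVb _ _) (norm_nonneg _) ((norm_nonneg _).trans (hUb _ _))
        _ = _ := by field_simp
  refine ⟨isTraceClass_of_nuclear hform hmu hmv (hw.const_mul _) huv, ?_, hdiag.integral_prod_left⟩
  have : Fact ((2 : ℝ≥0∞) ≠ ∞) := ⟨by simp⟩
  have h := hasTrace_of_nuclear hform hmu hmv (hw.const_mul _) huv
  rw [integral_integral_swap hdiag]
  convert h using 3 with x
  rw [hiv]
  refine integral_congr_ae ?_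
  filter_upwards [(hu x).coeFn_toLp] with s h1
  rw [h1, mul_comm]

end Kernels

/-! ### The trace of `π_ν(i ν e^{-a} ∂_b h)` -/

lemma integrable_exp_neg_mul_abs {c : ℝ} (hc : 0 < c) :
    Integrable fun x : ℝ => Real.exp (-(c * |x|)) := by
  rw [← integrableOn_univ, ← Iic_union_Ioi (a := (0 : ℝ))]
  refine IntegrableOn.union ?_ ?_
  · refine (integrableOn_exp_mul_Iic hc 0).congr_fun (fun x hx => ?_) measurableSet_Iic
    simp only [abs_of_nonpos (mem_Iic.1 hx)]; ring_nf
  · refine (integrableOn_exp_mul_Ioi (neg_lt_zero.2 hc) 0).congr_fun (fun x hx => ?_)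
      measurableSet_Ioi
    simp only [abs_of_pos (mem_Ioi.1 hx)]; ring_nf

lemma memLp_exp_neg_mul_abs {c : ℝ} (hc : 0 < c) :
    MemLp (fun x : ℝ => Real.exp (-(c * |x|))) 2 := by
  refine (memLp_two_iff_integrable_sq (by fun_prop)).2 ?_
  refine (integrable_exp_neg_mul_abs (c := 2 * c) (by positivity)).congr (.of_forall fun x => ?_)
  simp only [← Real.exp_nat_mul]
  push_cast; ring_nf

/-- Quadratic decay in `β` controls `s → -∞` and the explicit `e^{-s}` controls `s → +∞`; together
they give `e^{-|s|}`. Bounded support in `a = x - s` gives `|x| ≤ |s| + R`, so part of this decay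
can be traded for decay in `x`. -/
lemma exists_kernel_bound {ν : ℝ} (hν : ν * ν = 1) (k : AlgA) : ∃ D : ℝ, ∀ s x : ℝ,
    ‖(Real.exp (-s) : ℂ) * hat k (x - s) (ν * Real.exp (-s))‖
      ≤ D * Real.exp (-(1 / 4 * |x|)) ^ 2 * Real.exp (-(1 / 4 * |s|)) := by
  obtain ⟨C, R, hC, hR, h⟩ := exists_hat_bound k
  refine ⟨C * Real.exp R, fun s x => ?_⟩
  obtain ⟨h1, h2⟩ := h (x - s) (ν * Real.exp (-s))
  rw [norm_mul, Complex.norm_real, Real.norm_of_nonneg (Real.exp_pos _).le]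
  by_cases hx : R < |x - s|
  · rw [h2 hx, norm_zero, mul_zero]; positivity
  · have hx' : |x| ≤ |s| + R := by
      have := abs_add_le (x - s) s
      rw [sub_add_cancel] at this
      linarith [not_lt.1 hx]
    have e1 : (ν * Real.exp (-s)) ^ 2 = Real.exp (-s) ^ 2 := by
      rw [mul_pow, sq ν, hν, one_mul]
    rw [e1] at h1
    -- The left side is `1` for `s ≥ 0` and `e^{-2s}` for `s < 0`.
    have e2 : Real.exp |s| * Real.exp (-s) ≤ 1 + Real.exp (-s) ^ 2 := by
      rcases abs_cases s with ⟨h, _⟩ | ⟨h, _⟩ <;> rw [h]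
      · rw [← Real.exp_add]; simp; positivity
      · rw [sq]; linarith
    have e3 : Real.exp |s| * (Real.exp (-s) * ‖hat k (x - s) (ν * Real.exp (-s))‖) ≤ C := by
      rw [← mul_assoc]
      exact (mul_le_mul_of_nonneg_right e2 (norm_nonneg _)).trans h1
    have e4 : Real.exp (-s) * ‖hat k (x - s) (ν * Real.exp (-s))‖ ≤ C * Real.exp (-|s|) := by
      rw [Real.exp_neg |s|, ← div_eq_mul_inv, le_div_iff₀ (Real.exp_pos _), mul_comm]
      exact e3
    refine e4.trans ?_
    rw [mul_assoc, mul_assoc, ← Real.exp_nat_mul, ← Real.exp_add, ← Real.exp_add]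
    refine mul_le_mul_of_nonneg_left (Real.exp_le_exp.2 ?_) hC
    push_cast
    linarith [abs_nonneg s]

/-- The kernel of the resolvent `(1 + d/dt)⁻¹`. -/
def resolventKernel (x t : ℝ) : ℂ := if x ≤ t then (Real.exp (x - t) : ℂ) else 0

lemma stronglyMeasurable_resolventKernel :
    StronglyMeasurable fun q : ℝ × ℝ => resolventKernel q.1 q.2 := by
  refine (Measurable.ite (measurableSet_le measurable_fst measurable_snd) ?_
    measurable_const).stronglyMeasurable
  fun_prop

/-- On the support `|t| - |x| ≤ t - x`, and a quarter of the exponent suffices. -/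
lemma norm_resolventKernel_le (x t : ℝ) :
    ‖resolventKernel x t‖ ≤ (Real.exp (-(1 / 4 * |x|)))⁻¹ * Real.exp (-(1 / 4 * |t|)) := by
  rw [← Real.exp_neg, ← Real.exp_add, resolventKernel]
  split_ifs with h
  · rw [Complex.norm_real, Real.norm_of_nonneg (Real.exp_pos _).le]
    refine Real.exp_le_exp.2 ?_
    have := abs_sub_abs_le_abs_sub t x
    rw [abs_of_nonneg (sub_nonneg.2 h)] at this
    linarith
  · rw [norm_zero]; positivity

lemma integral_mul_resolventKernel (h : AlgA) (s t β : ℝ) :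
    ∫ x, hat (h + dirDeriv (1, 0) h) (x - s) β * resolventKernel x t = hat h (t - s) β := by
  rw [hat_eq_integral_Iic, ← integral_indicator measurableSet_Iic,
    ← integral_sub_right_eq_self ((Iic (t - s)).indicator _) s]
  congr 1; funext x
  simp only [resolventKernel, indicator, mem_Iic, sub_le_sub_iff_right]
  split_ifs
  · rw [mul_comm, sub_sub_sub_cancel_right]
  · rw [mul_zero]

lemma isTraceClass_hasTrace_piOp_twist {ν : ℝ} (hν : ν * ν = 1) (h : AlgA) :
    IsTraceClass (piOp ν (twist ν h)) ∧
      HasTrace (piOp ν (twist ν h)) (∫ s : ℝ, (Real.exp (-s) : ℂ) * hat h 0 (ν * Real.exp (-s))) ∧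
      Integrable fun s : ℝ => (Real.exp (-s) : ℂ) * hat h 0 (ν * Real.exp (-s)) := by
  obtain ⟨D, hD⟩ := exists_kernel_bound hν (h + dirDeriv (1, 0) h)
  have hU : StronglyMeasurable fun q : ℝ × ℝ => (Real.exp (-q.1) : ℂ) *
      hat (h + dirDeriv (1, 0) h) (q.2 - q.1) (ν * Real.exp (-q.1)) := by
    refine (by fun_prop : Continuous fun q : ℝ × ℝ =>
      (Real.exp (-q.1) : ℂ)).stronglyMeasurable.mul ?_
    exact (stronglyMeasurable_hat _).comp_measurable
      (by fun_prop : Measurable fun q : ℝ × ℝ => (q.2 - q.1, ν * Real.exp (-q.1)))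
  have hid : ∀ s t : ℝ, ∫ x, (Real.exp (-s) : ℂ) *
      hat (h + dirDeriv (1, 0) h) (x - s) (ν * Real.exp (-s)) * resolventKernel x t
      = (Real.exp (-s) : ℂ) * hat h (t - s) (ν * Real.exp (-s)) := fun s t => by
    simp only [mul_assoc, integral_const_mul, integral_mul_resolventKernel]
  have := isTraceClass_hasTrace_of_kernel (T := piOp ν (twist ν h)) hU
    stronglyMeasurable_resolventKernel
    (integrable_exp_neg_mul_abs (by norm_num)) (memLp_exp_neg_mul_abs (by norm_num))
    (fun x => Real.exp_pos _) hD norm_resolventKernel_le (fun ψ => by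
      filter_upwards [piOp_ae ν (twist ν h) ψ, piFun_twist_ae hν h ψ] with s h1 h2
      rw [h1, h2, ← integral_const_mul]
      simp only [hid]
      rw [← integral_add_left_eq_self (fun t => (Real.exp (-s) : ℂ) *
        hat h (t - s) (ν * Real.exp (-s)) * ψ t) s]
      simp only [add_sub_cancel_left, mul_assoc])
  simpa only [hid, sub_self] using this

/-! ### The substitution `β = ν e^{-s}` -/

lemma integral_image_mul_exp_neg {ν : ℝ} (hν : ν * ν = 1) (g : ℝ → ℂ) :
    (IntegrableOn g (range fun s : ℝ => ν * Real.exp (-s)) ↔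
      Integrable fun s : ℝ => (Real.exp (-s) : ℂ) * g (ν * Real.exp (-s))) ∧
    ∫ β in range fun s : ℝ => ν * Real.exp (-s), g β
      = ∫ s : ℝ, (Real.exp (-s) : ℂ) * g (ν * Real.exp (-s)) := by
  have hd : ∀ s ∈ (univ : Set ℝ), HasDerivWithinAt (fun s : ℝ => ν * Real.exp (-s))
      (ν * (Real.exp (-s) * -1)) univ s := fun s _ =>
    (((hasDerivAt_neg s).exp).const_mul ν).hasDerivWithinAt
  have hν0 : ν ≠ 0 := by rintro rfl; simp at hν
  have hinj : InjOn (fun s : ℝ => ν * Real.exp (-s)) univ := fun s _ t _ hst =>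
    neg_injective (Real.exp_injective (mul_left_cancel₀ hν0 hst))
  have habs : ∀ s : ℝ, |ν * (Real.exp (-s) * -1)| = Real.exp (-s) := fun s => by
    have : |ν| = 1 := by
      rw [← sq_eq_sq₀ (abs_nonneg _) zero_le_one, sq_abs, sq, hν, one_pow]
    rw [abs_mul, this, one_mul, mul_neg_one, abs_neg, abs_of_pos (Real.exp_pos _)]
  have h1 := integrableOn_image_iff_integrableOn_abs_deriv_smul MeasurableSet.univ hd hinj g
  have h2 := integral_image_eq_integral_abs_deriv_smul MeasurableSet.univ hd hinj g
  simp only [image_univ, habs, integrableOn_univ, Measure.restrict_univ, Complex.real_smul]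
    at h1 h2
  exact ⟨h1, h2⟩

lemma range_exp_neg : (range fun s : ℝ => (1 : ℝ) * Real.exp (-s)) = Ioi 0 := by
  ext β
  simp only [mem_range, mem_Ioi, one_mul]
  exact ⟨fun ⟨s, hs⟩ => hs ▸ Real.exp_pos _, fun h => ⟨-Real.log β, by rw [neg_neg, Real.exp_log h]⟩⟩

lemma range_neg_exp_neg : (range fun s : ℝ => (-1 : ℝ) * Real.exp (-s)) = Iio 0 := by
  ext β
  simp only [mem_range, mem_Iio, neg_one_mul]
  refine ⟨fun ⟨s, hs⟩ => hs ▸ neg_lt_zero.2 (Real.exp_pos _), fun h => ⟨-Real.log (-β), ?_⟩⟩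
  rw [neg_neg, Real.exp_log (neg_pos.2 h), neg_neg]

/-! ### Identification of the unbounded operators -/

lemma le_ofBounded {H : Type*} [NormedAddCommGroup H] [InnerProductSpace ℂ H] {R : H →ₗ.[ℂ] H}
    {T : H →L[ℂ] H} (h : ∀ x : R.domain, R x = T x) : R ≤ ofBounded T :=
  ⟨fun _ _ => Submodule.mem_top, fun x y hxy => by rw [h x, hxy]; rfl⟩

lemma mem_theta_domain {φ : Hil} :
    φ ∈ theta.domain ↔ MemLp (fun s : ℝ => (Real.exp (-s / 2) : ℂ) * φ s) 2 volume := Iff.rfl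

lemma theta_ae (φ : theta.domain) :
    theta φ =ᵐ[volume] fun s => (Real.exp (-s / 2) : ℂ) * (φ : Hil) s :=
  MemLp.coeFn_toLp φ.2

lemma thetaSq_ae (φ : thetaSq.domain) :
    thetaSq φ =ᵐ[volume] fun s => (Real.exp (-s) : ℂ) * (φ : Hil) s := by
  obtain ⟨φ, h1, h2⟩ := φ
  filter_upwards [theta_ae ⟨_, h2⟩, theta_ae ⟨φ, h1⟩] with s hs1 hs2
  refine hs1.trans ?_
  rw [hs2, ← mul_assoc, ← Complex.ofReal_mul, ← Real.exp_add]
  congr 3; ring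

/-- Moving the weights `e^{-s}` through the integrated representation. -/
lemma piFun_weight_ae {ν : ℝ} (hν : ν * ν = 1) (f : AlgA) (α : ℝ) (φ : Hil) :
    ∀ᵐ s : ℝ, (Real.exp (-(α * s)) : ℂ) *
        piFun ν f (fun t => (Real.exp (-((1 - α) * t)) : ℂ) * φ t) s
      = piFun ν (twist ν (expMul α f)) φ s := by
  filter_upwards [piFun_twist_expMul_ae hν (expMul α f) φ] with s hs
  rw [hs, piFun, piFun, ← integral_const_mul, ← integral_const_mul]
  congr 1; funext p
  -- The inner weight is evaluated at `t = s + a`, which leaves `e^{-s}` and the factor `e^{-a}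
  -- e^{αa}`. The integrands then agree pointwise, so the weighted `φ` need not lie in `L²`.
  have h : Real.exp (-(α * s)) * Real.exp (-((1 - α) * (s + p.1)))
      = Real.exp (-s) * (Real.exp (-1 * p.1) * Real.exp (α * p.1)) := by
    rw [← Real.exp_add, ← Real.exp_add, ← Real.exp_add]; congr 1; ring
  have h' := congrArg (fun x : ℝ => (x : ℂ)) h
  simp only [Complex.ofReal_mul] at h'
  simp only [expMul_apply, piGroup]
  linear_combination (Real.exp p.1 * f p * Complex.exp (ν * Complex.I * p.2 * Real.exp (-s)) *
    φ (s + p.1)) * h'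

lemma dense_compactly_supported :
    Dense {φ : Hil | ∃ g : ℝ → ℂ, Continuous g ∧ HasCompactSupport g ∧ φ =ᵐ[volume] g} := by
  refine Metric.dense_iff.2 fun φ r hr => ?_
  obtain ⟨g, hgs, hgn, hgc, hg⟩ := (Lp.memLp φ).exists_hasCompactSupport_eLpNorm_sub_le (by simp)
    (ε := ENNReal.ofReal (r / 2)) (by simpa using hr)
  refine ⟨hg.toLp, ?_, g, hgc, hgs, hg.coeFn_toLp⟩
  rw [Metric.mem_ball, dist_comm, Lp.dist_def]
  have : eLpNorm (⇑φ - ⇑hg.toLp) 2 volume ≤ ENNReal.ofReal (r / 2) := by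
    refine (eLpNorm_congr_ae ?_).trans_le hgn
    exact (Filter.EventuallyEq.refl _ _).sub hg.coeFn_toLp
  refine (ENNReal.toReal_mono ENNReal.ofReal_ne_top this).trans_lt ?_
  rw [ENNReal.toReal_ofReal (by positivity)]
  linarith

lemma mem_theta_domain_of_compactly_supported {φ : Hil} {g : ℝ → ℂ} (hg : Continuous g)
    (hgs : HasCompactSupport g) (h : φ =ᵐ[volume] g) :
    φ ∈ theta.domain := by
  have hc : Continuous fun s : ℝ => (Real.exp (-s / 2) : ℂ) * g s := by fun_prop
  refine mem_theta_domain.2 ((hc.memLp_of_hasCompactSupport hgs.mul_left).ae_eq ?_)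
  filter_upwards [h] with s hs
  rw [hs]

lemma dense_thetaSq_domain : Dense (thetaSq.domain : Set Hil) := by
  refine dense_compactly_supported.mono ?_
  rintro φ ⟨g, hg, hgs, h⟩
  have h1 := mem_theta_domain_of_compactly_supported hg hgs h
  refine ⟨h1, ?_⟩
  refine mem_theta_domain_of_compactly_supported
    (g := fun s => (Real.exp (-s / 2) : ℂ) * g s) (by fun_prop) hgs.mul_left ?_
  filter_upwards [theta_ae ⟨φ, h1⟩, h] with s h2 h3
  rw [h2, h3]

lemma dense_theta_domain : Dense (theta.domain : Set Hil) :=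
  dense_thetaSq_domain.mono fun _ h => h.1

lemma piThetaSq_spec {ν : ℝ} (hν : ν * ν = 1) (f : AlgA) :
    Dense ((piThetaSq ν f).domain : Set Hil) ∧
      piThetaSq ν f ≤ ofBounded (piOp ν (twist ν (expMul 0 f))) := by
  refine ⟨dense_thetaSq_domain.mono fun φ h => ⟨h, Submodule.mem_top⟩, le_ofBounded ?_⟩
  rintro ⟨φ, h1, h2⟩
  refine Lp.ext ?_
  filter_upwards [piOp_ae ν f (thetaSq ⟨φ, h1⟩), piOp_ae ν (twist ν (expMul 0 f)) φ,
    piFun_weight_ae hν f 0 φ] with s e1 e2 e3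
  refine e1.trans ?_
  rw [e2, ← e3, piFun_congr ν f (thetaSq_ae ⟨φ, h1⟩)]
  simp

lemma thetaPiTheta_spec {ν : ℝ} (hν : ν * ν = 1) (f : AlgA) :
    Dense ((thetaPiTheta ν f).domain : Set Hil) ∧
      thetaPiTheta ν f ≤ ofBounded (piOp ν (twist ν (expMul (1 / 2) f))) := by
  have key : ∀ φ : theta.domain,
      (fun s : ℝ => (Real.exp (-s / 2) : ℂ) * piOp ν f (theta φ) s)
        =ᵐ[volume] piOp ν (twist ν (expMul (1 / 2) f)) φ := fun φ => by
    filter_upwards [piOp_ae ν f (theta φ), piOp_ae ν (twist ν (expMul (1 / 2) f)) φ,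
      piFun_weight_ae hν f (1 / 2) φ] with s e1 e2 e3
    rw [e1, e2, ← e3, piFun_congr ν f (theta_ae φ)]
    have : ∀ t : ℝ, -t / 2 = -((1 - 1 / 2) * t) := fun t => by ring
    have h' : -(1 / 2 * s) = -((1 - 1 / 2) * s) := by ring
    simp only [this, h']
  constructor
  · refine dense_theta_domain.mono fun φ h => ⟨⟨h, Submodule.mem_top⟩, ?_⟩
    -- By `key` the weighted function is already the value of a bounded operator, so maximality of
    -- the domain of `θ` imposes no further condition on `φ`.
    exact mem_theta_domain.2 ((Lp.memLp _).ae_eq (key ⟨φ, h⟩).symm)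
  · refine le_ofBounded ?_
    rintro ⟨φ, ⟨h1, h2⟩, h3⟩
    exact Lp.ext ((theta_ae ⟨_, h3⟩).trans (key ⟨φ, h1⟩))

lemma thetaSqPi_spec {ν : ℝ} (hν : ν * ν = 1) (f : AlgA) :
    Dense ((thetaSqPi ν f).domain : Set Hil) ∧
      thetaSqPi ν f ≤ ofBounded (piOp ν (twist ν (expMul 1 f))) := by
  have key : ∀ φ : Hil, (fun s : ℝ => (Real.exp (-s) : ℂ) * piOp ν f φ s)
      =ᵐ[volume] piOp ν (twist ν (expMul 1 f)) φ := fun φ => by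
    filter_upwards [piOp_ae ν f φ, piOp_ae ν (twist ν (expMul 1 f)) φ,
      piFun_weight_ae hν f 1 φ] with s e1 e2 e3
    rw [e1, e2, ← e3]
    simp
  have hdom : ∀ φ : Hil, piOp ν f φ ∈ thetaSq.domain := fun φ => by
    have h2 : MemLp (fun s : ℝ => (Real.exp (-s) : ℂ) * piOp ν f φ s) 2 :=
      (Lp.memLp _).ae_eq (key φ).symm
    have hm : AEStronglyMeasurable (fun s : ℝ => (Real.exp (-s / 2) : ℂ) * piOp ν f φ s) volume :=
      (by fun_prop : Continuous fun s : ℝ => (Real.exp (-s / 2) : ℂ)).aestronglyMeasurable.mul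
        (Lp.aestronglyMeasurable _)
    -- The natural domain of `θ²` also requires membership in the domain of `θ`; this follows by
    -- interpolation, `e^{-s/2} ≤ 1 + e^{-s}`.
    have h1 : piOp ν f φ ∈ theta.domain := by
      refine mem_theta_domain.2 (((Lp.memLp (piOp ν f φ)).norm.add h2.norm).of_le hm
        (.of_forall fun s => ?_))
      simp only [Pi.add_apply, norm_mul, Complex.norm_real, Real.norm_of_nonneg (Real.exp_pos _).le]
      rw [Real.norm_of_nonneg (by positivity)]
      have e : Real.exp (-s) = Real.exp (-s / 2) ^ 2 := by
        rw [← Real.exp_nat_mul]; congr 1; push_cast; ring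
      have : Real.exp (-s / 2) ≤ 1 + Real.exp (-s) := by
        rw [e]; nlinarith [sq_nonneg (Real.exp (-s / 2) - 1)]
      calc _ ≤ (1 + Real.exp (-s)) * ‖piOp ν f φ s‖ := by gcongr
        _ = _ := by ring
    refine ⟨h1, mem_theta_domain.2 (h2.ae_eq ?_)⟩
    filter_upwards [theta_ae ⟨_, h1⟩] with s hs
    rw [hs, ← mul_assoc, ← Complex.ofReal_mul, ← Real.exp_add]
    congr 3; ring
  refine ⟨dense_univ.mono fun φ _ => ⟨Submodule.mem_top, hdom φ⟩, le_ofBounded ?_⟩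
  rintro ⟨φ, h1, h2⟩
  exact Lp.ext ((thetaSq_ae ⟨_, h2⟩).trans (key φ))

/-- The trace depends on `e^{αa} f` only through its transform at `a = 0`, which is `f̃(0, β)` for
every `α`. -/
lemma integrableOn_and_traces {ν : ℝ} (hν : ν * ν = 1) (f : AlgA) {S : Set ℝ}
    (hS : (range fun s : ℝ => ν * Real.exp (-s)) = S) :
    IntegrableOn (fun β : ℝ => fTilde f 0 β) S ∧
      IsTraceClassWithTrace (piThetaSq ν f) (∫ β in S, fTilde f 0 β) ∧
      IsTraceClassWithTrace (thetaPiTheta ν f) (∫ β in S, fTilde f 0 β) ∧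
      IsTraceClassWithTrace (thetaSqPi ν f) (∫ β in S, fTilde f 0 β) := by
  subst hS
  obtain ⟨h1, h2⟩ := integral_image_mul_exp_neg hν (fun β => fTilde f 0 β)
  have he : ∀ (α β : ℝ), hat (expMul α f) 0 β = fTilde f 0 β := fun α β => by
    rw [hat_expMul]; simp [fTilde, hat]
  have ht := fun α => isTraceClass_hasTrace_piOp_twist hν (expMul α f)
  simp only [he, ← h1, ← h2] at ht
  exact ⟨(ht 0).2.2,
    ⟨(piThetaSq_spec hν f).1, _, (piThetaSq_spec hν f).2, (ht 0).1, (ht 0).2.1⟩,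
    ⟨(thetaPiTheta_spec hν f).1, _, (thetaPiTheta_spec hν f).2, (ht _).1, (ht _).2.1⟩,
    ⟨(thetaSqPi_spec hν f).1, _, (thetaSqPi_spec hν f).2, (ht 1).1, (ht 1).2.1⟩⟩

end KappaAffine

end

open MeasureTheory Set KappaAffine in
theorem mainTheorem7 (f : AlgA) :
    (IntegrableOn (fun β : ℝ => fTilde f 0 β) (Ioi 0) ∧
      IsTraceClassWithTrace (piThetaSq 1 f) (∫ β in Ioi (0 : ℝ), fTilde f 0 β) ∧
      IsTraceClassWithTrace (thetaPiTheta 1 f) (∫ β in Ioi (0 : ℝ), fTilde f 0 β) ∧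
      IsTraceClassWithTrace (thetaSqPi 1 f) (∫ β in Ioi (0 : ℝ), fTilde f 0 β)) ∧
    (IntegrableOn (fun β : ℝ => fTilde f 0 β) (Iio 0) ∧
      IsTraceClassWithTrace (piThetaSq (-1) f) (∫ β in Iio (0 : ℝ), fTilde f 0 β) ∧
      IsTraceClassWithTrace (thetaPiTheta (-1) f) (∫ β in Iio (0 : ℝ), fTilde f 0 β) ∧
      IsTraceClassWithTrace (thetaSqPi (-1) f) (∫ β in Iio (0 : ℝ), fTilde f 0 β)) := by
  refine ⟨integrableOn_and_traces (by norm_num) f range_exp_neg, ?_⟩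
  have := integrableOn_and_traces (ν := -1) (by norm_num) f range_neg_exp_neg
  exact this
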